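/- Let $n\ge 2$. There is a constant $C_n>0$ depending only on $n$ such that the following holds. Let $\Omega\subset\mathbb{R}^n$ be open, bounded and convex, let $L:\mathbb{R}^n\to\mathbb{R}^n$ be an affine bijection with $L(\Omega)\subset B_1=\{|x|<1\}$, and write $|L|$ and $\det L$ for the spectral norm and the determinant of the linear part of $L$. Let $\Lambda\in\mathbb{R}$, let $f\in L^1(\Omega)$ satisfy $0\le f\le\Lambda$ almost everywhere, and let $g:\overline{\Omega}\to\mathbb{R}$ be convex. Let $u\in C(\overline\Omega)$ be a convex Alexandrov solution of $\det D^2u=f$ in $\Omega$, $u=g$ on $\partial\Omega$; that is, $u=g$ on $\partial\Omega$ and, for every Borel set $A\subset\Omega$, $$\Big|\bigcup_{x\in A}\partial u(x)\Big|=\int_A f\,dx,\qquad \partial u(x)=\{\xi\in\mathbb{R}^n : u(y)\ge u(x)+\langle\xi,y-x\rangle\ \text{ for all } y\in\Omega\}.$$ For $v:\overline\Omega\to\mathbb{R}$ and $\delta\ge0$ let $\omega_v(\delta)=\sup\{|v(x)-v(y)| : x,y\in\overline\Omega,\ |x-y|\le\delta\}\in[0,\infty]$ be the modulus of continuity. Then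 for all $\delta\ge0$ $$\omega_u(\delta)\le\omega_g(\delta)+C_n\,|\det L|^{-2/n}\,\Lambda^{1/n}\,a_n(|L|\delta),$$ where $a_n(t)=t^{2/n}$ for $n\ge3$, and $a_2(t)=t(1-\ln t)$ for $0<t\le1$, $a_2(0)=0$, $a_2(t)=1$ for $t>1$. In particular, if $0<\alpha<1$ and $g\in C^{\alpha}(\overline\Omega)$ (that is, $g$ is Hölder continuous with exponent $\alpha$ on $\overline\Omega$), then $u\in C^{\min\{\alpha,2/n\}}(\overline\Omega)$. -/

import Mathlib

open MeasureTheory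
open scoped NNReal ENNReal

/-- Euclidean space `ℝⁿ` with its Euclidean norm. -/
abbrev Rn (n : ℕ) : Type := EuclideanSpace ℝ (Fin n)

/-- The subdifferential `∂u(x)` of `u` relative to `Ω`: all slopes `ξ` with
`u y ≥ u x + ⟨ξ, y - x⟩` for every `y ∈ Ω`. -/
def subdifferential {n : ℕ} (Ω : Set (Rn n)) (u : Rn n → ℝ) (x : Rn n) : Set (Rn n) :=
  {ξ | ∀ y ∈ Ω, u x + inner ℝ ξ (y - x) ≤ u y}

/-- The Monge–Ampère measure `μ_u(A) = |⋃_{x ∈ A} ∂u(x)|` for `A ⊆ Ω`. -/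
noncomputable def mongeAmpere {n : ℕ} (Ω : Set (Rn n)) (u : Rn n → ℝ) (A : Set (Rn n)) : ℝ≥0∞ :=
  volume (⋃ x ∈ A, subdifferential Ω u x)

/-- `u` is a continuous convex Alexandrov solution on `closure Ω` of
`det D²u = f` in `Ω`, `u = g` on `∂Ω`. -/
structure IsAlexandrovSolution {n : ℕ} (Ω : Set (Rn n)) (f g u : Rn n → ℝ) : Prop where
  convexOn : ConvexOn ℝ (closure Ω) u
  continuousOn : ContinuousOn u (closure Ω)
  mongeAmpere_eq : ∀ A : Set (Rn n), A ⊆ Ω → MeasurableSet A →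
    mongeAmpere Ω u A = ∫⁻ x in A, ENNReal.ofReal (f x)
  boundary_eq : ∀ x ∈ frontier Ω, u x = g x

/-- The modulus of continuity on a set `S`, as an element of `[0, ∞]`:
the supremum of `|u x - u y|` over all `x, y ∈ S` with `|x - y| ≤ δ`. -/
noncomputable def modulusOfContinuity {n : ℕ} (S : Set (Rn n)) (u : Rn n → ℝ) (δ : ℝ) : ℝ≥0∞ :=
  ⨆ x ∈ S, ⨆ y ∈ S, ⨆ _ : ‖x - y‖ ≤ δ, ENNReal.ofReal |u x - u y|

/-- The spectral norm of the linear part of an affine bijection of `ℝⁿ`. -/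
noncomputable def affineNorm {n : ℕ} (L : Rn n ≃ᵃ[ℝ] Rn n) : ℝ :=
  ‖LinearMap.toContinuousLinearMap (L.linear : Rn n →ₗ[ℝ] Rn n)‖

/-- The determinant of the linear part of an affine bijection of `ℝⁿ`. -/
noncomputable def affineDet {n : ℕ} (L : Rn n ≃ᵃ[ℝ] Rn n) : ℝ :=
  LinearMap.det (L.linear : Rn n →ₗ[ℝ] Rn n)

/-- The growth function: `t ^ (2/n)` for `n ≠ 2`, and for `n = 2` the function `t (1 - ln t)`
on `[0, 1]` (with value `0` at `t = 0`), continued by its maximal value `1` for `t > 1`. -/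
noncomputable def growth (n : ℕ) (t : ℝ) : ℝ :=
  if n = 2 then min t 1 * (1 - Real.log (min t 1)) else t ^ (2 / (n : ℝ))

/-! By convexity an increment `u y - u x` only grows when the segment slides forward until `y`
reaches the boundary. There `u = g`, and if `ℓ` supports `g` at `x`, the increment is `g y - g x`
plus `ℓ x - u x`, where `ℓ ≤ u` on the boundary. So it suffices to bound `ℓ - u` near a boundary
point (`affine_sub_le_growth_dist`).

Let `t` be the distance, after applying `L`, to a supporting hyperplane of `L(Ω)` at that point. The
slab `t < s` lies in a box with sides `s, 2, ..., 2`. In the Alexandrov maximum principle the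
product of the sides enters squared, once from the volume and once from the set of slopes, hence a
bound of order `s ^ (2/n)`. Subtracting a multiple of `t` from `ℓ` to absorb the bound `A` on `t =
s` gives `ℓ - u ≤ A t / s + K s ^ (2/n)` in the slab (`affine_sub_le_of_level`). Iterating over `s =
2 / 2 ^ k` yields the power for `n ≥ 3`, and the logarithm for `n = 2` (`le_growth_of_halving`). -/

/-! ### Determinants, orthonormal bases and volumes of boxes. -/

theorem LinearMap.det_adjoint_real {E : Type*} [NormedAddCommGroup E] [InnerProductSpace ℝ E]
    [FiniteDimensional ℝ E] (f : E →ₗ[ℝ] E) :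
    LinearMap.det (LinearMap.adjoint f) = LinearMap.det f := by
  let b := stdOrthonormalBasis ℝ E
  rw [← LinearMap.det_toMatrix b.toBasis, ← LinearMap.det_toMatrix b.toBasis f,
    LinearMap.toMatrix_adjoint, Matrix.det_conjTranspose]
  simp

theorem OrthonormalBasis.volume_setOf_inner_mem {n : ℕ} (b : OrthonormalBasis (Fin n) ℝ (Rn n))
    (S : Fin n → Set ℝ) (hS : ∀ i, MeasurableSet (S i)) :
    volume {z : Rn n | ∀ i, inner ℝ (b i) z ∈ S i} = ∏ i, volume (S i) := by
  have h := (PiLp.volume_preserving_ofLp (Fin n)).comp b.measurePreserving_repr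
  have h2 := h.measure_preimage (MeasurableSet.univ_pi hS).nullMeasurableSet
  rw [volume_pi_pi] at h2
  rw [← h2]
  congr 1
  ext z
  simp [OrthonormalBasis.repr_apply_apply]

theorem OrthonormalBasis.exists_apply_eq {n : ℕ} (i : Fin n) (ν : Rn n) (hν : ‖ν‖ = 1) :
    ∃ b : OrthonormalBasis (Fin n) ℝ (Rn n), b i = ν := by
  have ho : Orthonormal ℝ (({i} : Set (Fin n)).domRestrict (fun _ : Fin n => ν)) := by
    rw [orthonormal_iff_ite]
    rintro ⟨a, ha⟩ ⟨c, hc⟩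
    simp only [Set.mem_singleton_iff] at ha hc
    subst ha hc
    simp [hν]
  obtain ⟨b, hb⟩ := ho.exists_orthonormalBasis_extension_of_card_eq (by simp)
  exact ⟨b, hb i rfl⟩

/-! ### The Alexandrov maximum principle. -/

/-- Moving the graph of an affine function downwards until it touches `u` from below: slopes close
to that of an affine minorant on `frontier G` belong to the subdifferential at a point of `G`. -/
theorem exists_mem_subdifferential_of_lt {n : ℕ} {Ω G : Set (Rn n)} {u : Rn n → ℝ}
    (hb : Bornology.IsBounded Ω) (hG : IsOpen G) (hGΩ : G ⊆ Ω)
    (hu : ConvexOn ℝ (closure Ω) u) (huc : ContinuousOn u (closure Ω))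
    {p ξ x : Rn n} {c : ℝ} (hx : x ∈ G) (hfr : ∀ z ∈ frontier G, c + inner ℝ p z ≤ u z)
    (hξ : ∀ z ∈ closure G, inner ℝ (ξ - p) (z - x) < c + inner ℝ p x - u x) :
    ∃ z ∈ G, ξ ∈ subdifferential Ω u z := by
  have hcl : closure G ⊆ closure Ω := closure_mono hGΩ
  have hcomp : IsCompact (closure G) := (hb.subset hGΩ).isCompact_closure
  have hcont : ContinuousOn (fun z => u z - inner ℝ ξ z) (closure G) :=
    (huc.mono hcl).sub (by fun_prop)
  obtain ⟨z, hz, hmin⟩ := hcomp.exists_isMinOn ⟨x, subset_closure hx⟩ hcont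
  have hzG : z ∈ G := by
    by_contra hzG
    have hzf : z ∈ frontier G := by rw [hG.frontier_eq]; exact ⟨hz, hzG⟩
    have h1 := hfr z hzf
    have h2 := hξ z hz
    have h3 := hmin (subset_closure hx)
    simp only [Set.mem_ofPred_eq] at h3
    simp only [inner_sub_left, inner_sub_right] at h2
    linarith
  refine ⟨z, hzG, fun y hy => ?_⟩
  have hconv : ConvexOn ℝ (closure Ω) (fun z => u z - inner ℝ ξ z) := by
    refine hu.sub ?_
    exact (innerₗ (Rn n) ξ).concaveOn hu.1
  have hloc : IsLocalMinOn (fun z => u z - inner ℝ ξ z) (closure Ω) z := by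
    refine Filter.Eventually.filter_mono nhdsWithin_le_nhds ?_
    filter_upwards [hG.mem_nhds hzG] with w hw using hmin (subset_closure hw)
  have h := IsMinOn.of_isLocalMinOn_of_convexOn (subset_closure (hGΩ hzG)) hloc hconv
    (subset_closure hy)
  simp only [Set.mem_ofPred_eq] at h
  rw [inner_sub_right]
  linarith

/-- An Alexandrov maximum principle on sets contained in the preimage of a box. -/
theorem alexandrov_maximum_principle_box {n : ℕ} (hn : 0 < n) {Ω G : Set (Rn n)} {u : Rn n → ℝ}
    {Λ : ℝ} (hb : Bornology.IsBounded Ω) (hG : IsOpen G) (hGΩ : G ⊆ Ω)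
    (hu : ConvexOn ℝ (closure Ω) u) (huc : ContinuousOn u (closure Ω)) (hΛ : 0 ≤ Λ)
    (hMA : mongeAmpere Ω u G ≤ ENNReal.ofReal Λ * volume G)
    (M : Rn n →ₗ[ℝ] Rn n) (hM : LinearMap.det M ≠ 0)
    (b : OrthonormalBasis (Fin n) ℝ (Rn n)) (a l : Fin n → ℝ) (hl : ∀ i, 0 < l i)
    (hbox : ∀ z ∈ G, ∀ i, inner ℝ (b i) (M z) ∈ Set.Icc (a i) (a i + l i))
    {p : Rn n} {c : ℝ} (hfr : ∀ z ∈ frontier G, c + inner ℝ p z ≤ u z) {x : Rn n} (hx : x ∈ G)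
    (hpos : 0 ≤ c + inner ℝ p x - u x) :
    (c + inner ℝ p x - u x) ^ n ≤
      (n / 2 : ℝ) ^ n * (Λ * ((∏ i, l i) ^ 2 / LinearMap.det M ^ 2)) := by
  set m := c + inner ℝ p x - u x with hm
  rcases hpos.eq_or_lt with h0 | hpos
  · rw [← h0, zero_pow hn.ne']
    positivity
  have hn' : (0 : ℝ) < n := by exact_mod_cast hn
  -- For `η ∈ B` each coordinate contributes less than `m / n` to `⟨η, M (z - x)⟩`, so the slope `p
  -- + M* η` is attained in `G`.
  set B : Set (Rn n) :=
    {η | ∀ i, inner ℝ (b i) η ∈ Set.Ioo (-(m / (n * l i))) (m / (n * l i))} with hB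
  have hbox' : ∀ z ∈ closure G, ∀ i, inner ℝ (b i) (M z) ∈ Set.Icc (a i) (a i + l i) := by
    intro z hz i
    have hc : IsClosed {z : Rn n | inner ℝ (b i) (M z) ∈ Set.Icc (a i) (a i + l i)} := by
      refine isClosed_Icc.preimage ?_
      have : Continuous M := M.continuous_of_finiteDimensional
      fun_prop
    exact closure_minimal (fun w hw => hbox w hw i) hc hz
  have hsub : (fun η => p + η) '' (LinearMap.adjoint M '' B) ⊆
      ⋃ z ∈ G, subdifferential Ω u z := by
    rintro _ ⟨_, ⟨η, hη, rfl⟩, rfl⟩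
    have := exists_mem_subdifferential_of_lt hb hG hGΩ hu huc (ξ := p + LinearMap.adjoint M η)
      hx hfr ?_
    · simpa using this
    intro z hz
    rw [add_sub_cancel_left, LinearMap.adjoint_inner_left, map_sub,
      ← b.sum_inner_mul_inner η (M z - M x)]
    have hsum : (∑ _i : Fin n, m / n) = m := by
      simp; field_simp
    rw [← hm, ← hsum]
    have : Nonempty (Fin n) := ⟨⟨0, hn⟩⟩
    refine Finset.sum_lt_sum_of_nonempty Finset.univ_nonempty fun i _ => ?_
    have h1 := hη i
    have h2 := hbox' z hz i
    have h3 := hbox x hx i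
    have h4 : |inner ℝ (b i) (M z - M x)| ≤ l i := by
      rw [inner_sub_right, abs_le]
      constructor <;> linarith [h2.1, h2.2, h3.1, h3.2]
    have h5 : |inner ℝ η (b i)| < m / (n * l i) := by
      rw [real_inner_comm, abs_lt]; exact h1
    calc inner ℝ η (b i) * inner ℝ (b i) (M z - M x)
        ≤ |inner ℝ η (b i)| * |inner ℝ (b i) (M z - M x)| := by
          rw [← abs_mul]; exact le_abs_self _
      _ ≤ |inner ℝ η (b i)| * l i := by gcongr
      _ < m / (n * l i) * l i := by gcongr; exact hl i
      _ = m / n := by have := (hl i).ne'; field_simp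
  have hvolB : volume B = ENNReal.ofReal (∏ i, 2 * m / (n * l i)) := by
    rw [hB, b.volume_setOf_inner_mem _ fun i => measurableSet_Ioo, ENNReal.ofReal_prod_of_nonneg]
    · refine Finset.prod_congr rfl fun i _ => ?_
      rw [Real.volume_Ioo]; congr 1; ring
    · intro i _
      have := hl i
      positivity
  have hvolG : volume G ≤ ENNReal.ofReal (|(LinearMap.det M)⁻¹| * ∏ i, l i) := by
    have hGsub : G ⊆ M ⁻¹' {z | ∀ i, inner ℝ (b i) z ∈ Set.Icc (a i) (a i + l i)} := hbox
    refine (measure_mono hGsub).trans ?_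
    rw [Measure.addHaar_preimage_linearMap _ hM,
      b.volume_setOf_inner_mem _ fun i => measurableSet_Icc, ENNReal.ofReal_mul (abs_nonneg _),
      ENNReal.ofReal_prod_of_nonneg fun i _ => (hl i).le]
    simp
  have hchain : ENNReal.ofReal (|LinearMap.det M| * ∏ i, 2 * m / (n * l i)) ≤
      ENNReal.ofReal (Λ * (|(LinearMap.det M)⁻¹| * ∏ i, l i)) := by
    calc _ = volume ((fun η => p + η) '' (LinearMap.adjoint M '' B)) := by
          rw [Set.image_add_left, measure_preimage_add, Measure.addHaar_image_linearMap,
            LinearMap.det_adjoint_real, hvolB, ENNReal.ofReal_mul (abs_nonneg _)]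
      _ ≤ mongeAmpere Ω u G := measure_mono hsub
      _ ≤ ENNReal.ofReal Λ * volume G := hMA
      _ ≤ _ := by rw [ENNReal.ofReal_mul hΛ]; gcongr
  have hP : 0 < ∏ i, l i := Finset.prod_pos fun i _ => hl i
  rw [ENNReal.ofReal_le_ofReal_iff (by positivity), Finset.prod_div_distrib, Finset.prod_mul_distrib, Finset.prod_mul_distrib,
    Finset.prod_const, Finset.prod_const, Finset.prod_const, Finset.card_univ, Fintype.card_fin,
    abs_inv, ← mul_pow] at hchain
  have hd : 0 < |LinearMap.det M| := abs_pos.2 hM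
  rw [← sq_abs (LinearMap.det M)]
  generalize |LinearMap.det M| = d at *
  generalize ∏ i, l i = P at *
  have hk : 0 < (n / 2 : ℝ) ^ n * P / d := by positivity
  calc m ^ n = (d * ((2 * m) ^ n / ((n : ℝ) ^ n * P))) * ((n / 2 : ℝ) ^ n * P / d) := by
        rw [mul_pow, div_pow]; field_simp
    _ ≤ (Λ * (d⁻¹ * P)) * ((n / 2 : ℝ) ^ n * P / d) := by gcongr
    _ = _ := by field_simp

/-! ### The growth function and the dyadic iteration. -/

theorem growth_two (t : ℝ) : growth 2 t = min t 1 * (1 - Real.log (min t 1)) := by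
  simp [growth]

theorem growth_of_ne_two {n : ℕ} (hn : n ≠ 2) (t : ℝ) : growth n t = t ^ (2 / (n : ℝ)) := by
  simp [growth, hn]

theorem exists_dyadic_bracket {t : ℝ} (h0 : 0 < t) (h2 : t ≤ 2) :
    ∃ k : ℕ, t ≤ 2 / 2 ^ k ∧ 2 / 2 ^ k < 2 * t := by
  obtain ⟨k, hk1, hk2⟩ := exists_nat_pow_near (x := 2 / t) (y := 2)
    ((one_le_div h0).2 h2) one_lt_two
  refine ⟨k, ?_, ?_⟩
  · rw [le_div_iff₀ (by positivity)]
    rw [le_div_iff₀ h0] at hk1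
    linarith
  · rw [div_lt_iff₀ (by positivity)]
    rw [div_lt_iff₀ h0, pow_succ] at hk2
    linarith

/-- Passing from `t ≤ s` to `t ≤ s / 2` turns a bound `A` into `A / 2 + K s ^ (2/n)`. The halved
term decays faster than the added one if `n ≥ 3`, and at the same rate if `n = 2`. -/
theorem le_growth_of_halving {n : ℕ} (hn : 2 ≤ n) {X : Type*} {S : Set X} {t D : X → ℝ} {K : ℝ}
    (hK : 0 ≤ K) (ht : ∀ z ∈ S, t z ∈ Set.Ioc 0 2) (h0 : ∀ z ∈ S, D z ≤ 3 * K)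
    (hstep : ∀ s A : ℝ, 0 < s → 0 ≤ A → (∀ z ∈ S, t z = s → D z ≤ A) →
      ∀ z ∈ S, t z < s → D z ≤ A * (t z / s) + K * s ^ (2 / (n : ℝ)))
    {z : X} (hz : z ∈ S) : D z ≤ 20 * K * growth n (t z) := by
  have hhalf : ∀ s A : ℝ, 0 < s → 0 ≤ A → (∀ z ∈ S, t z ≤ s → D z ≤ A) →
      ∀ z ∈ S, t z ≤ s / 2 → D z ≤ A / 2 + K * s ^ (2 / (n : ℝ)) := by
    intro s A hs hA h z hz htz
    refine (hstep s A hs hA (fun w hw hws => h w hw hws.le) z hz (by linarith)).trans ?_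
    have : t z / s ≤ 1 / 2 := by rw [div_le_iff₀ hs]; linarith
    nlinarith
  obtain ⟨htz0, htz2⟩ := ht z hz
  obtain ⟨k, hk1, hk2⟩ := exists_dyadic_bracket htz0 htz2
  rcases hn.eq_or_lt with rfl | hn3
  -- With `s = 2 / 2 ^ k`, half of `K s (2k + 2)` plus `K s` is `K (s / 2) (2(k + 1) + 2)`; the
  -- factor linear in `k` becomes the logarithm.
  · have key : ∀ k : ℕ, ∀ z ∈ S, t z ≤ 2 / 2 ^ k → D z ≤ K * (2 / 2 ^ k) * (2 * k + 2) := by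
      intro k
      induction k with
      | zero => intro z hz _; have := h0 z hz; norm_num; linarith
      | succ k ih =>
        intro z hz htz
        refine (hhalf (2 / 2 ^ k) _ (by positivity) (by positivity) ih z hz ?_).trans ?_
        · rw [pow_succ] at htz; rwa [div_div]
        · refine le_of_eq ?_
          norm_num
          rw [pow_succ]
          field_simp
    rw [growth_two]
    rcases le_total (t z) 1 with h1 | h1
    · rw [min_eq_left h1]
      have hlog := Real.log_le_log htz0 hk1
      rw [Real.log_div two_ne_zero (by positivity), Real.log_pow] at hlog
      have hl2 := Real.log_two_gt_d9
      have hl0 : Real.log (t z) ≤ 0 := Real.log_nonpos htz0.le h1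
      -- This uses `1 / log 2 < 2`.
      have hk : (k : ℝ) ≤ 1 - 2 * Real.log (t z) := by
        by_contra! hcon
        nlinarith
      calc D z ≤ K * (2 / 2 ^ k) * (2 * k + 2) := key k z hz hk1
        _ ≤ K * (2 * t z) * (2 * (1 - 2 * Real.log (t z)) + 2) := by gcongr
        _ = 8 * K * (t z * (1 - Real.log (t z))) := by ring
        _ ≤ 20 * K * (t z * (1 - Real.log (t z))) := by
          have : 0 ≤ t z * (1 - Real.log (t z)) := mul_nonneg htz0.le (by linarith)
          gcongr
          norm_num
    · rw [min_eq_right h1]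
      have := h0 z hz
      simp
      linarith
  · set a : ℝ := 2 / (n : ℝ) with ha
    have hn3' : (3 : ℝ) ≤ n := by exact_mod_cast hn3
    have ha0 : 0 ≤ a := by positivity
    have ha1 : a ≤ 2 / 3 := by rw [ha]; gcongr
    -- The induction closes when `10 / 2 + 1 ≤ 10 (1/2) ^ a`, that is `(1/2) ^ a ≥ 3/5`, which fails
    -- for `n = 2`.
    have h2a : (31 / 50 : ℝ) ≤ (1 / 2) ^ a := by
      refine le_trans ?_ (Real.rpow_le_rpow_of_exponent_ge (by norm_num) (by norm_num) ha1)
      have hcube : ((1 / 2 : ℝ) ^ (2 / 3 : ℝ)) ^ 3 = 1 / 4 := by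
        rw [← Real.rpow_natCast, ← Real.rpow_mul (by norm_num)]
        norm_num
      refine le_of_pow_le_pow_left₀ three_ne_zero (by positivity) ?_
      rw [hcube]
      norm_num
    have key : ∀ k : ℕ, ∀ z ∈ S, t z ≤ 2 / 2 ^ k → D z ≤ 10 * K * (2 / 2 ^ k) ^ a := by
      intro k
      induction k with
      | zero =>
        intro z hz _
        have := h0 z hz
        have h1 : 1 ≤ (2 : ℝ) ^ a := Real.one_le_rpow one_le_two ha0
        simp only [pow_zero, div_one]
        nlinarith
      | succ k ih =>
        intro z hz htz
        refine (hhalf (2 / 2 ^ k) _ (by positivity) (by positivity) ih z hz ?_).trans ?_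
        · rw [pow_succ] at htz; rwa [div_div]
        · rw [show (2 / 2 ^ (k + 1) : ℝ) = 1 / 2 * (2 / 2 ^ k) by rw [pow_succ]; field_simp,
            Real.mul_rpow (by norm_num) (by positivity)]
          have hp : 0 ≤ K * (2 / 2 ^ k : ℝ) ^ a := by positivity
          nlinarith
    rw [growth_of_ne_two (by omega)]
    calc D z ≤ 10 * K * (2 / 2 ^ k) ^ a := key k z hz hk1
      _ ≤ 10 * K * (2 * t z) ^ a := by gcongr
      _ = 10 * K * (2 ^ a * (t z) ^ a) := by rw [Real.mul_rpow (by norm_num) htz0.le]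
      _ ≤ 10 * K * (2 * (t z) ^ a) := by
        gcongr
        calc (2 : ℝ) ^ a ≤ 2 ^ (1 : ℝ) :=
              Real.rpow_le_rpow_of_exponent_le one_le_two (by linarith)
          _ = 2 := Real.rpow_one 2
      _ = _ := by ring

theorem growth_mono {n : ℕ} (hn : 2 ≤ n) {s t : ℝ} (hs : 0 ≤ s) (hst : s ≤ t) :
    growth n s ≤ growth n t := by
  rcases eq_or_ne n 2 with rfl | h2
  · rw [growth_two, growth_two]
    have h1 : 0 ≤ min s 1 := le_min hs zero_le_one
    have h2 : min t 1 ≤ 1 := min_le_right _ _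
    have h3 : min s 1 ≤ min t 1 := min_le_min_right 1 hst
    generalize min s 1 = x at *
    generalize min t 1 = y at *
    rcases h1.eq_or_lt with rfl | hx
    · simp only [zero_mul]
      exact mul_nonneg h3 (by have := Real.log_nonpos h3 h2; linarith)
    · have hy : 0 < y := hx.trans_le h3
      have hlog : Real.log (y / x) ≤ y / x - 1 := Real.log_le_sub_one_of_pos (by positivity)
      rw [Real.log_div hy.ne' hx.ne'] at hlog
      have hly := Real.log_nonpos hy.le h2
      have : x * (Real.log y - Real.log x) ≤ y - x := by
        calc _ ≤ x * (y / x - 1) := by gcongr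
          _ = _ := by field_simp
      nlinarith
  · rw [growth_of_ne_two h2, growth_of_ne_two h2]
    exact Real.rpow_le_rpow hs hst (by positivity)

theorem exists_rpow_le_mul_rpow {α β : ℝ} (hβ : 0 < β) (hαβ : β ≤ α) (R : ℝ) :
    ∃ C : ℝ, 0 ≤ C ∧ ∀ t, 0 ≤ t → t ≤ R → t ^ α ≤ C * t ^ β := by
  refine ⟨(max R 0) ^ (α - β), by positivity, fun t ht htR => ?_⟩
  rcases ht.eq_or_lt with rfl | ht
  · rw [Real.zero_rpow (hβ.trans_le hαβ).ne', Real.zero_rpow hβ.ne', mul_zero]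
  calc t ^ α = t ^ (α - β) * t ^ β := by rw [← Real.rpow_add ht]; congr 1; ring
    _ ≤ _ := by
      gcongr
      exact htR.trans (le_max_left _ _)

/-- For `n = 2` the strict inequality `β < 1` leaves a power `1 - β` to absorb the logarithm. -/
theorem exists_growth_le_rpow {n : ℕ} (hn : 2 ≤ n) {β : ℝ} (hβ : 0 < β) (hβ1 : β < 1)
    (hβn : β ≤ 2 / (n : ℝ)) (R : ℝ) :
    ∃ C : ℝ, 0 ≤ C ∧ ∀ t, 0 ≤ t → t ≤ R → growth n t ≤ C * t ^ β := by
  rcases eq_or_ne n 2 with rfl | h2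
  · refine ⟨1 + 1 / (1 - β), ?_, fun t ht _ => ?_⟩
    · have : 0 < 1 - β := by linarith
      positivity
    have hb : 0 < 1 - β := by linarith
    rcases ht.eq_or_lt with rfl | ht
    · simp [growth_two, hβ.ne']
    rw [growth_two]
    have hx : 0 < min t 1 := lt_min ht one_pos
    have hx1 : min t 1 ≤ 1 := min_le_right _ _
    have hxt : min t 1 ≤ t := min_le_left _ _
    generalize min t 1 = x at *
    have hlog := Real.log_le_rpow_div (x := x⁻¹) (by positivity) hb
    rw [Real.log_inv] at hlog
    have h1 : x ≤ x ^ β := by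
      conv_lhs => rw [← Real.rpow_one x]
      exact Real.rpow_le_rpow_of_exponent_ge hx hx1 hβ1.le
    have h2 : x * (x⁻¹ ^ (1 - β) / (1 - β)) = x ^ β / (1 - β) := by
      rw [Real.inv_rpow hx.le, Real.rpow_sub hx, Real.rpow_one]
      field_simp
    calc x * (1 - Real.log x) = x + x * -Real.log x := by ring
      _ ≤ x ^ β + x * (x⁻¹ ^ (1 - β) / (1 - β)) := by gcongr
      _ = (1 + 1 / (1 - β)) * x ^ β := by rw [h2]; ring
      _ ≤ _ := by gcongr
  · obtain ⟨C, hC, h⟩ := exists_rpow_le_mul_rpow hβ hβn R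
    exact ⟨C, hC, fun t ht htR => (growth_of_ne_two h2 t).trans_le (h t ht htR)⟩

/-! ### Boundary decay of affine minorants minus `u`. -/

theorem affine_sub_le_of_level {n : ℕ} (hn : 2 ≤ n) {Ω : Set (Rn n)} {u : Rn n → ℝ} {Λ : ℝ}
    (hO : IsOpen Ω) (hb : Bornology.IsBounded Ω) (hu : ConvexOn ℝ (closure Ω) u)
    (huc : ContinuousOn u (closure Ω)) (hΛ : 0 ≤ Λ)
    (hMA : ∀ G ⊆ Ω, IsOpen G → mongeAmpere Ω u G ≤ ENNReal.ofReal Λ * volume G)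
    (M : Rn n →ₗ[ℝ] Rn n) (hM : LinearMap.det M ≠ 0)
    (b : OrthonormalBasis (Fin n) ℝ (Rn n)) (i₀ : Fin n) (a : Fin n → ℝ)
    (hbox : ∀ z ∈ Ω, ∀ i, inner ℝ (b i) (M z) ∈ Set.Icc (a i) (a i + 2)) (τ : ℝ)
    (hτ : ∀ z ∈ Ω, 0 < inner ℝ (b i₀) (M z) - τ)
    {p : Rn n} {c : ℝ} (hfr : ∀ z ∈ frontier Ω, c + inner ℝ p z ≤ u z)
    {s A : ℝ} (hs : 0 < s) (hA : 0 ≤ A)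
    (hlevel : ∀ z ∈ Ω, inner ℝ (b i₀) (M z) - τ = s → c + inner ℝ p z - u z ≤ A)
    {x : Rn n} (hx : x ∈ Ω) (hxs : inner ℝ (b i₀) (M x) - τ < s) :
    c + inner ℝ p x - u x ≤ A * ((inner ℝ (b i₀) (M x) - τ) / s) +
      2 * n * |LinearMap.det M| ^ (-(2 / (n : ℝ))) * Λ ^ (1 / (n : ℝ)) * s ^ (2 / (n : ℝ)) := by
  set t : Rn n → ℝ := fun z => inner ℝ (b i₀) (M z) - τ with ht
  have hMc : Continuous M := M.continuous_of_finiteDimensional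
  have htc : Continuous t := by fun_prop
  set G : Set (Rn n) := Ω ∩ {z | t z < s} with hG
  have hGo : IsOpen G := hO.inter (isOpen_lt htc continuous_const)
  -- The tilted function `c + ⟨p, z⟩ - A t(z) / s` is at most `u` on the whole frontier of the slab:
  -- on `t = s` by `hlevel`, on the frontier of `Ω` because `t ≥ 0`.
  set p' : Rn n := p - (A / s) • LinearMap.adjoint M (b i₀) with hp'
  set c' : ℝ := c + A / s * τ with hc'
  have haff : ∀ z, c' + inner ℝ p' z = c + inner ℝ p z - A * (t z / s) := by
    intro z
    simp only [hp', hc', ht, inner_sub_left, real_inner_smul_left, LinearMap.adjoint_inner_left]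
    ring
  have htcl : ∀ z ∈ closure Ω, 0 ≤ t z := fun z hz =>
    closure_minimal (fun w hw => (hτ w hw).le) (isClosed_le continuous_const htc) hz
  have hfr' : ∀ z ∈ frontier G, c' + inner ℝ p' z ≤ u z := by
    intro z hz
    rw [hGo.frontier_eq] at hz
    have hzcl : z ∈ closure Ω := closure_mono Set.inter_subset_left hz.1
    have hzs : t z ≤ s :=
      closure_minimal (fun w hw => (le_of_lt hw.2 : t w ≤ s)) (isClosed_le htc continuous_const) hz.1
    rw [haff]
    by_cases hzΩ : z ∈ Ω
    · have hzs' : t z = s := by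
        refine le_antisymm hzs ?_
        by_contra! hcon
        exact hz.2 ⟨hzΩ, hcon⟩
      have := hlevel z hzΩ hzs'
      rw [hzs', div_self hs.ne']
      linarith
    · have h1 := hfr z (by rw [hO.frontier_eq]; exact ⟨hzcl, hzΩ⟩)
      have h2 : 0 ≤ A * (t z / s) := mul_nonneg hA (div_nonneg (htcl z hzcl) hs.le)
      linarith
  have hn' : (0 : ℝ) < n := by positivity
  have hd : 0 < |LinearMap.det M| := abs_pos.2 hM
  set K := 2 * n * |LinearMap.det M| ^ (-(2 / (n : ℝ))) * Λ ^ (1 / (n : ℝ)) * s ^ (2 / (n : ℝ))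
    with hK
  have hK0 : 0 ≤ K := by positivity
  suffices hmain : c' + inner ℝ p' x - u x ≤ K by
    rw [haff] at hmain
    change _ ≤ A * (t x / s) + K
    linarith
  rcases le_total (c' + inner ℝ p' x - u x) 0 with hneg | hpos
  · exact hneg.trans hK0
  have hmax := alexandrov_maximum_principle_box (by omega) hb hGo Set.inter_subset_left hu huc hΛ
    (hMA G Set.inter_subset_left hGo) M hM b (Function.update a i₀ τ)
    (Function.update (fun _ => 2) i₀ s) ?_ ?_ hfr' ⟨hx, hxs⟩ hpos
  · have hprod : ∏ i, Function.update (fun _ => (2 : ℝ)) i₀ s i = s * 2 ^ (n - 1) := by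
      rw [Finset.prod_update_of_mem (Finset.mem_univ _), Finset.prod_const, Finset.card_sdiff]
      simp
    rw [hprod] at hmax
    refine le_of_pow_le_pow_left₀ (by omega : n ≠ 0) hK0 (hmax.trans ?_)
    have h1 : ∀ r : ℝ, 0 ≤ r → (r ^ (2 / (n : ℝ))) ^ n = r ^ 2 := by
      intro r hr
      rw [← Real.rpow_natCast, ← Real.rpow_mul hr, div_mul_cancel₀ _ hn'.ne']
      norm_num
    have h2 : (Λ ^ (1 / (n : ℝ))) ^ n = Λ := by
      rw [← Real.rpow_natCast, ← Real.rpow_mul hΛ, div_mul_cancel₀ _ hn'.ne', Real.rpow_one]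
    have hKn : K ^ n = 2 ^ n * (n : ℝ) ^ n * (LinearMap.det M ^ 2)⁻¹ * Λ * s ^ 2 := by
      rw [hK, mul_pow, mul_pow, mul_pow, mul_pow, h1 s hs.le, h2, Real.rpow_neg hd.le, inv_pow,
        h1 _ hd.le, sq_abs]
    rw [hKn]
    obtain ⟨k, rfl⟩ : ∃ k, n = k + 1 := ⟨n - 1, by omega⟩
    rw [Nat.add_sub_cancel]
    clear hKn hmax
    generalize ((k + 1 : ℕ) : ℝ) = N at *
    have hd2 : 0 < LinearMap.det M ^ 2 := by positivity
    calc (N / 2) ^ (k + 1) * (Λ * ((s * 2 ^ k) ^ 2 / LinearMap.det M ^ 2))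
        = 2 ^ k / 2 * (N ^ (k + 1) * (LinearMap.det M ^ 2)⁻¹ * Λ * s ^ 2) := by
          rw [div_pow]; field_simp; ring
      _ ≤ 2 ^ (k + 1) * (N ^ (k + 1) * (LinearMap.det M ^ 2)⁻¹ * Λ * s ^ 2) := by
          refine mul_le_mul_of_nonneg_right ?_ (by positivity)
          have : (0 : ℝ) < 2 ^ k := by positivity
          rw [pow_succ]
          linarith
      _ = _ := by ring
  · intro i
    rcases eq_or_ne i i₀ with rfl | hi <;> simp [*]
  · intro z hz i
    rcases eq_or_ne i i₀ with rfl | hi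
    · have h1 := hτ z hz.1
      have h2 : t z < s := hz.2
      simp only [ht] at h2
      simp only [Function.update_self]
      constructor <;> linarith
    · simpa [hi] using hbox z hz.1 i

theorem affine_sub_le_growth {n : ℕ} (hn : 2 ≤ n) {Ω : Set (Rn n)} {u : Rn n → ℝ} {Λ : ℝ}
    (hO : IsOpen Ω) (hb : Bornology.IsBounded Ω) (hu : ConvexOn ℝ (closure Ω) u)
    (huc : ContinuousOn u (closure Ω)) (hΛ : 0 ≤ Λ)
    (hMA : ∀ G ⊆ Ω, IsOpen G → mongeAmpere Ω u G ≤ ENNReal.ofReal Λ * volume G)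
    (M : Rn n →ₗ[ℝ] Rn n) (hM : LinearMap.det M ≠ 0)
    (b : OrthonormalBasis (Fin n) ℝ (Rn n)) (i₀ : Fin n) (a : Fin n → ℝ)
    (hbox : ∀ z ∈ Ω, ∀ i, inner ℝ (b i) (M z) ∈ Set.Icc (a i) (a i + 2)) (τ : ℝ)
    (hτ : ∀ z ∈ Ω, inner ℝ (b i₀) (M z) - τ ∈ Set.Ioc 0 2)
    {p : Rn n} {c : ℝ} (hfr : ∀ z ∈ frontier Ω, c + inner ℝ p z ≤ u z) {x : Rn n} (hx : x ∈ Ω) :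
    c + inner ℝ p x - u x ≤
      20 * (2 * n * |LinearMap.det M| ^ (-(2 / (n : ℝ))) * Λ ^ (1 / (n : ℝ))) *
        growth n (inner ℝ (b i₀) (M x) - τ) := by
  have hK : 0 ≤ 2 * n * |LinearMap.det M| ^ (-(2 / (n : ℝ))) * Λ ^ (1 / (n : ℝ)) := by positivity
  have hstep := fun (s A : ℝ) (hs : 0 < s) (hA : 0 ≤ A) hlevel (z : Rn n) (hz : z ∈ Ω) hzs =>
    affine_sub_le_of_level hn hO hb hu huc hΛ hMA M hM b i₀ a hbox τ (fun w hw => (hτ w hw).1)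
      hfr (s := s) (A := A) hs hA hlevel hz hzs
  refine le_growth_of_halving (t := fun z => inner ℝ (b i₀) (M z) - τ)
    (D := fun z => c + inner ℝ p z - u z) hn hK hτ (fun z hz => ?_) hstep hx
  -- Since `t ≤ 2` on `Ω`, the level `t = 3` is empty, so `A = 0` is admissible and starts the
  -- iteration.
  have h := hstep 3 0 three_pos le_rfl (fun w hw hw3 => ?_) z hz (by linarith [(hτ z hz).2])
  · refine h.trans ?_
    rw [zero_mul, zero_add, mul_comm]
    gcongr
    calc (3 : ℝ) ^ (2 / (n : ℝ)) ≤ 3 ^ (1 : ℝ) := by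
          refine Real.rpow_le_rpow_of_exponent_le (by norm_num) ?_
          rw [div_le_one (by positivity)]
          exact_mod_cast hn
      _ = 3 := Real.rpow_one 3
  · linarith [(hτ w hw).2]

/-- An affine minorant of the boundary values of `u` exceeds `u` in the interior by at most a
multiple of the growth function of the distance to the boundary. -/
theorem affine_sub_le_growth_dist {n : ℕ} (hn : 2 ≤ n) {Ω : Set (Rn n)} {u : Rn n → ℝ} {Λ : ℝ}
    (hO : IsOpen Ω) (hb : Bornology.IsBounded Ω) (hΩ : Convex ℝ Ω) (L : Rn n ≃ᵃ[ℝ] Rn n)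
    (hL : Set.MapsTo L Ω (Metric.ball 0 1)) (hu : ConvexOn ℝ (closure Ω) u)
    (huc : ContinuousOn u (closure Ω)) (hΛ : 0 ≤ Λ)
    (hMA : ∀ G ⊆ Ω, IsOpen G → mongeAmpere Ω u G ≤ ENNReal.ofReal Λ * volume G)
    {p : Rn n} {c : ℝ} (hfr : ∀ z ∈ frontier Ω, c + inner ℝ p z ≤ u z) {x y : Rn n} (hx : x ∈ Ω)
    (hy : y ∈ frontier Ω) :
    c + inner ℝ p x - u x ≤
      20 * (2 * n * |affineDet L| ^ (-(2 / (n : ℝ))) * Λ ^ (1 / (n : ℝ))) *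
        growth n (affineNorm L * ‖x - y‖) := by
  set M : Rn n →ₗ[ℝ] Rn n := (L.linear : Rn n →ₗ[ℝ] Rn n) with hMdef
  have hLM : ∀ z w, L z - L w = M z - M w := by
    intro z w
    have := L.toAffineMap.linearMap_vsub z w
    simpa [hMdef] using this.symm
  have hMdet : LinearMap.det M ≠ 0 := (LinearEquiv.isUnit_det' L.linear).ne_zero
  have hLc : Continuous L := L.toAffineMap.continuous_of_finiteDimensional
  have hLcl : ∀ z ∈ closure Ω, ‖L z‖ ≤ 1 := fun z hz =>
    closure_minimal (fun w hw => by simpa using (mem_ball_zero_iff.1 (hL hw)).le)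
      (isClosed_le hLc.norm continuous_const) hz
  rw [hO.frontier_eq] at hy
  obtain ⟨f, hf⟩ := geometric_hahn_banach_point_open hΩ hO hy.2
  set w : Rn n := (InnerProductSpace.toDual ℝ (Rn n)).symm f with hw
  have hfw : ∀ z, f z = inner ℝ w z := fun z => by simp [hw]
  -- `v` is the normal at `L y` of the image under `L` of the supporting hyperplane at `y`; normals
  -- transform by the inverse adjoint.
  set v : Rn n := LinearMap.adjoint (L.linear.symm : Rn n →ₗ[ℝ] Rn n) w with hv
  have hvM : ∀ z, inner ℝ v (M z) = f z := fun z => by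
    rw [hv, LinearMap.adjoint_inner_left, hfw, hMdef]
    simp
  have hv0 : v ≠ 0 := by
    intro h0
    have h1 := hf x hx
    rw [← hvM, ← hvM, h0] at h1
    simp at h1
  have hvn : 0 < ‖v‖ := norm_pos_iff.2 hv0
  set i₀ : Fin n := ⟨0, by omega⟩
  obtain ⟨b, hbν⟩ := OrthonormalBasis.exists_apply_eq i₀ (‖v‖⁻¹ • v) (by
    rw [norm_smul, norm_inv, norm_norm, inv_mul_cancel₀ hvn.ne'])
  have hbd : ∀ i z, |inner ℝ (b i) z| ≤ ‖z‖ := fun i z => by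
    simpa using abs_real_inner_le_norm (b i) z
  have ht : ∀ z, inner ℝ (b i₀) (M z) - inner ℝ (b i₀) (M y) = inner ℝ (b i₀) (L z - L y) :=
    fun z => by rw [hLM, inner_sub_right]
  have hpos : ∀ z ∈ Ω, 0 < inner ℝ (b i₀) (M z) - inner ℝ (b i₀) (M y) := fun z hz => by
    rw [hbν, real_inner_smul_left, real_inner_smul_left, hvM, hvM, ← mul_sub]
    exact mul_pos (inv_pos.2 hvn) (sub_pos.2 (hf z hz))
  have hmain := affine_sub_le_growth hn hO hb hu huc hΛ hMA M hMdet b i₀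
    (fun i => -1 - inner ℝ (b i) (L 0)) ?_ (inner ℝ (b i₀) (M y)) ?_ hfr hx
  · refine hmain.trans ?_
    change _ ≤ 20 * (2 * n * |LinearMap.det M| ^ (-(2 / (n : ℝ))) * Λ ^ (1 / (n : ℝ))) * _
    gcongr
    refine growth_mono hn (hpos x hx).le ?_
    rw [← inner_sub_right, ← map_sub]
    refine (le_abs_self _).trans ((hbd _ _).trans ?_)
    exact ContinuousLinearMap.le_opNorm (LinearMap.toContinuousLinearMap M) (x - y)
  · intro z hz i
    have h1 : M z = L z - L 0 := by rw [hLM, map_zero, sub_zero]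
    have h2 := abs_le.1 ((hbd i (L z)).trans (hLcl z (subset_closure hz)))
    rw [h1, inner_sub_right]
    constructor <;> linarith [h2.1, h2.2]
  · intro z hz
    refine ⟨hpos z hz, ?_⟩
    rw [ht]
    refine (le_abs_self _).trans ((hbd _ _).trans ((norm_sub_le _ _).trans ?_))
    linarith [hLcl z (subset_closure hz), hLcl y hy.1]

/-! ### Convex functions up to the boundary. -/

/-- In `Ω` this separates `(x, g x)` from the open strict epigraph. As `g` may jump at the boundary,
closure points are reached by convexity, through the midpoint with `x`, rather than by a limit. -/
theorem ConvexOn.exists_subgradient {n : ℕ} {Ω : Set (Rn n)} {g : Rn n → ℝ} (hO : IsOpen Ω)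
    (hΩ : Convex ℝ Ω) (hg : ConvexOn ℝ (closure Ω) g) {x : Rn n} (hx : x ∈ Ω) :
    ∃ p : Rn n, ∀ z ∈ closure Ω, g x + inner ℝ p (z - x) ≤ g z := by
  have hgΩ : ConvexOn ℝ Ω g := hg.subset subset_closure hΩ
  have hcont : ContinuousOn g Ω := hgΩ.continuousOn hO
  have hopen : IsOpen {q : Rn n × ℝ | q.1 ∈ Ω ∧ g q.1 < q.2} := by
    have h1 : ContinuousOn (fun q : Rn n × ℝ => q.2 - g q.1) (Prod.fst ⁻¹' Ω) :=
      continuousOn_snd.sub (hcont.comp continuousOn_fst fun q hq => hq)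
    have h2 := h1.isOpen_inter_preimage (hO.preimage continuous_fst) (isOpen_Ioi (a := (0 : ℝ)))
    convert h2 using 1
    ext q
    simp
  obtain ⟨f, hf⟩ := geometric_hahn_banach_point_open hgΩ.convex_strict_epigraph hopen
    (x := (x, g x)) (by simp)
  have hdec : ∀ z r, f (z, r) = f (z, 0) + r * f (0, 1) := by
    intro z r
    rw [← smul_eq_mul, ← map_smul, ← map_add]
    simp
  have hpos : 0 < f (0, 1) := by
    have := hf (x, g x + 1) ⟨hx, by simp⟩
    rw [hdec x (g x), hdec x (g x + 1)] at this
    linarith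
  set w : Rn n := (InnerProductSpace.toDual ℝ (Rn n)).symm
    (f.comp (ContinuousLinearMap.inl ℝ (Rn n) ℝ)) with hw
  have hfw : ∀ z, inner ℝ w z = f (z, 0) := fun z => by simp [hw]
  have hint : ∀ z ∈ Ω, g x + inner ℝ (-(f (0, 1))⁻¹ • w) (z - x) ≤ g z := by
    intro z hz
    refine le_of_forall_gt_imp_ge_of_dense fun r hr => ?_
    have := (hf (z, r) ⟨hz, hr⟩).le
    rw [hdec x, hdec z] at this
    rw [real_inner_smul_left, inner_sub_right, hfw, hfw]
    have h2 : (f (0, 1))⁻¹ * (f (x, 0) + g x * f (0, 1)) ≤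
        (f (0, 1))⁻¹ * (f (z, 0) + r * f (0, 1)) := by gcongr
    have h3 : ∀ r, (f (0, 1))⁻¹ * (r * f (0, 1)) = r := fun r => by field_simp
    rw [mul_add, mul_add, h3, h3] at h2
    linarith
  refine ⟨-(f (0, 1))⁻¹ • w, fun z hz => ?_⟩
  have hmid : (1 / 2 : ℝ) • x + (1 / 2 : ℝ) • z ∈ Ω := by
    have := hΩ.combo_interior_closure_mem_interior (x := x) (y := z) (a := 1 / 2) (b := 1 / 2)
      (by rwa [hO.interior_eq]) hz (by norm_num) (by norm_num) (by norm_num)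
    rwa [hO.interior_eq] at this
  have h1 := hint _ hmid
  have h2 := hg.2 (subset_closure hx) hz (by norm_num : (0 : ℝ) ≤ 1 / 2)
    (by norm_num : (0 : ℝ) ≤ 1 / 2) (by norm_num)
  rw [show (1 / 2 : ℝ) • x + (1 / 2 : ℝ) • z - x = (1 / 2 : ℝ) • (z - x) by module,
    real_inner_smul_right] at h1
  simp only [smul_eq_mul] at h2
  linarith

/-- Increments of a convex function along a line increase up to the boundary. -/
theorem ConvexOn.exists_frontier_increment {n : ℕ} {Ω : Set (Rn n)} {u : Rn n → ℝ} (hO : IsOpen Ω)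
    (hb : Bornology.IsBounded Ω) (hu : ConvexOn ℝ (closure Ω) u) {x y : Rn n}
    (hx : x ∈ closure Ω) (hy : y ∈ closure Ω) (hxy : x ≠ y) :
    ∃ x' ∈ closure Ω, ∃ y' ∈ frontier Ω, x' - y' = x - y ∧ u y - u x ≤ u y' - u x' := by
  have hv : 0 < ‖y - x‖ := norm_pos_iff.2 (sub_ne_zero.2 hxy.symm)
  set φ : ℝ → Rn n := fun r => x + r • (y - x) with hφ
  have hφc : Continuous φ := by fun_prop
  obtain ⟨R, hR⟩ := hb.closure.exists_norm_le
  have hcomp : IsCompact (Set.Ici 1 ∩ φ ⁻¹' closure Ω) := by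
    refine Metric.isCompact_of_isClosed_isBounded
      (isClosed_Ici.inter (isClosed_closure.preimage hφc)) ?_
    refine (Metric.isBounded_Icc (1 : ℝ) ((R + ‖x‖) / ‖y - x‖)).subset fun r hr => ⟨hr.1, ?_⟩
    rw [le_div_iff₀ hv]
    have h1 := hR _ hr.2
    have h2 : ‖r • (y - x)‖ ≤ ‖φ r‖ + ‖x‖ := by
      have : r • (y - x) = φ r - x := by simp [hφ]
      rw [this]
      exact norm_sub_le _ _
    rw [norm_smul, Real.norm_of_nonneg (zero_le_one.trans hr.1)] at h2
    linarith
  obtain ⟨r, ⟨hr1, hr⟩, hmax⟩ := hcomp.exists_isMaxOn ⟨1, Set.self_mem_Ici, by simpa [hφ] using hy⟩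
    continuousOn_id
  have hr1 : 1 ≤ r := hr1
  have hr0 : 0 < r := one_pos.trans_le hr1
  have hr' : φ r ∈ closure Ω := hr
  have hfr : φ r ∈ frontier Ω := by
    rw [hO.frontier_eq]
    refine ⟨hr, fun hrΩ => ?_⟩
    have hev : ∀ᶠ q in nhdsWithin r (Set.Ioi r), φ q ∈ Ω :=
      nhdsWithin_le_nhds (hφc.continuousAt.eventually_mem (hO.mem_nhds hrΩ))
    obtain ⟨q, hq, hrq⟩ := (hev.and self_mem_nhdsWithin).exists
    have hrq : r < q := hrq
    have := hmax ⟨(hr1.trans hrq.le : (1 : ℝ) ≤ q), subset_closure hq⟩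
    simp only [id] at this
    exact absurd hrq (not_lt.2 this)
  have hc0 : (0 : ℝ) ≤ 1 / r := by positivity
  have hc1 : (0 : ℝ) ≤ 1 - 1 / r := sub_nonneg.2 ((div_le_one hr0).2 hr1)
  have hri : r⁻¹ * r = 1 := inv_mul_cancel₀ hr0.ne'
  have hey : (1 - 1 / r) • x + (1 / r) • φ r = y := by
    rw [hφ]
    simp only [smul_add, smul_smul, one_div, hri]
    module
  have hex : (1 / r) • x + (1 - 1 / r) • φ r = φ r - (y - x) := by
    rw [hφ]
    simp only [smul_add, smul_smul, one_div, sub_mul, hri]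
    module
  -- `y` and `x' = φ r - (y - x)` are combinations of `x` and `φ r` with swapped weights, so the two
  -- inequalities add up to `u y + u x' ≤ u x + u (φ r)`.
  have h1 := hu.2 hx hr' hc1 hc0 (by ring)
  have h2 := hu.2 hx hr' hc0 hc1 (by ring)
  have h3 := hu.1 hx hr' hc0 hc1 (by ring)
  rw [hey] at h1
  rw [hex] at h2 h3
  refine ⟨_, h3, φ r, hfr, by abel, ?_⟩
  simp only [smul_eq_mul] at h1 h2
  linarith

/-! ### Moduli of continuity and the conclusion. -/

theorem ofReal_abs_sub_le_modulusOfContinuity {n : ℕ} {S : Set (Rn n)} {g : Rn n → ℝ} {δ : ℝ}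
    {x y : Rn n} (hx : x ∈ S) (hy : y ∈ S) (hxy : ‖x - y‖ ≤ δ) :
    ENNReal.ofReal |g x - g y| ≤ modulusOfContinuity S g δ :=
  le_iSup₂_of_le x hx <| le_iSup₂_of_le y hy <| le_iSup_of_le hxy le_rfl

/-- The modulus of continuity estimate, for a single one-sided increment. -/
theorem IsAlexandrovSolution.ofReal_sub_le {n : ℕ} (hn : 2 ≤ n) {Ω : Set (Rn n)}
    {f g u : Rn n → ℝ} {Λ : ℝ} (hO : IsOpen Ω) (hb : Bornology.IsBounded Ω) (hΩ : Convex ℝ Ω)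
    (L : Rn n ≃ᵃ[ℝ] Rn n) (hL : Set.MapsTo L Ω (Metric.ball 0 1)) (hΛ : 0 ≤ Λ)
    (hf : ∀ᵐ x ∂(volume.restrict Ω), 0 ≤ f x ∧ f x ≤ Λ) (hg : ConvexOn ℝ (closure Ω) g)
    (hu : IsAlexandrovSolution Ω f g u) {x y : Rn n} (hx : x ∈ closure Ω) (hy : y ∈ closure Ω)
    {δ : ℝ} (hxy : ‖x - y‖ ≤ δ) :
    ENNReal.ofReal (u y - u x) ≤ modulusOfContinuity (closure Ω) g δ +
      ENNReal.ofReal (40 * n * |affineDet L| ^ (-(2 / (n : ℝ))) * Λ ^ (1 / (n : ℝ)) *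
        growth n (affineNorm L * δ)) := by
  rcases eq_or_ne x y with rfl | hne
  · simp
  obtain ⟨x', hx', y', hy', hsub, hle⟩ := hu.convexOn.exists_frontier_increment hO hb hx hy hne
  have hy'cl : y' ∈ closure Ω := frontier_subset_closure hy'
  have hxy' : ‖x' - y'‖ ≤ δ := by rwa [hsub]
  have hgxy : ENNReal.ofReal (g y' - g x') ≤ modulusOfContinuity (closure Ω) g δ := by
    refine le_trans ?_ (ofReal_abs_sub_le_modulusOfContinuity hx' hy'cl hxy')
    rw [abs_sub_comm]
    exact ENNReal.ofReal_le_ofReal (le_abs_self _)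
  refine (ENNReal.ofReal_le_ofReal hle).trans ?_
  by_cases hx'Ω : x' ∈ Ω
  · have hMA : ∀ G ⊆ Ω, IsOpen G → mongeAmpere Ω u G ≤ ENNReal.ofReal Λ * volume G := by
      intro G hG hGo
      rw [hu.mongeAmpere_eq G hG hGo.measurableSet, ← setLIntegral_const]
      refine lintegral_mono_ae ?_
      filter_upwards [ae_restrict_of_ae_restrict_of_subset hG hf] with z hz
      exact ENNReal.ofReal_le_ofReal hz.2
    obtain ⟨p, hp⟩ := hg.exists_subgradient hO hΩ hx'Ω
    have hp' : ∀ z, (g x' - inner ℝ p x') + inner ℝ p z = g x' + inner ℝ p (z - x') := fun z => by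
      rw [inner_sub_right]; ring
    have hest := affine_sub_le_growth_dist hn hO hb hΩ L hL hu.convexOn hu.continuousOn hΛ hMA
      (p := p) (c := g x' - inner ℝ p x')
      (fun z hz => by
        rw [hp', hu.boundary_eq z hz]
        exact hp z (frontier_subset_closure hz)) hx'Ω hy'
    rw [sub_add_cancel] at hest
    have hmono : growth n (affineNorm L * ‖x' - y'‖) ≤ growth n (affineNorm L * δ) := by
      have : 0 ≤ affineNorm L := norm_nonneg _
      exact growth_mono hn (by positivity) (by gcongr)
    have hK : 0 ≤ 20 * (2 * n * |affineDet L| ^ (-(2 / (n : ℝ))) * Λ ^ (1 / (n : ℝ))) := by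
      positivity
    rw [hu.boundary_eq y' hy', show g y' - u x' = (g y' - g x') + (g x' - u x') by ring]
    refine ENNReal.ofReal_add_le.trans (add_le_add hgxy (ENNReal.ofReal_le_ofReal ?_))
    refine (hest.trans (mul_le_mul_of_nonneg_left hmono hK)).trans (le_of_eq ?_)
    ring
  · have hx'f : x' ∈ frontier Ω := by rw [hO.frontier_eq]; exact ⟨hx', hx'Ω⟩
    rw [hu.boundary_eq y' hy', hu.boundary_eq x' hx'f]
    exact hgxy.trans le_self_add

theorem ae_bound_nonneg {n : ℕ} {Ω : Set (Rn n)} {f : Rn n → ℝ} {Λ : ℝ} (hO : IsOpen Ω)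
    (hne : Ω.Nonempty) (hf : ∀ᵐ x ∂(volume.restrict Ω), 0 ≤ f x ∧ f x ≤ Λ) : 0 ≤ Λ := by
  have hvol : volume.restrict Ω ≠ 0 := by
    rw [Ne, Measure.restrict_eq_zero]
    exact (hO.measure_pos volume hne).ne'
  have := (ae_neBot.2 hvol)
  obtain ⟨x, hx⟩ := hf.exists
  exact hx.1.trans hx.2

theorem modulusOfContinuity_le_of_holderOnWith {n : ℕ} {S : Set (Rn n)} {g : Rn n → ℝ}
    {K α : ℝ≥0} (hg : HolderOnWith K α g S) (δ : ℝ) :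
    modulusOfContinuity S g δ ≤ ENNReal.ofReal (K * δ ^ (α : ℝ)) := by
  refine iSup₂_le fun x hx => iSup₂_le fun y hy => iSup_le fun hxy => ?_
  rw [← Real.dist_eq]
  refine ENNReal.ofReal_le_ofReal ((hg.dist_le hx hy).trans ?_)
  rw [dist_eq_norm]
  gcongr

theorem exists_holderOnWith_of_modulusOfContinuity_le {n : ℕ} {S : Set (Rn n)} {u : Rn n → ℝ}
    {β : ℝ≥0} {R C : ℝ} (hR : ∀ x ∈ S, ∀ y ∈ S, ‖x - y‖ ≤ R)
    (h : ∀ δ, 0 ≤ δ → δ ≤ R → modulusOfContinuity S u δ ≤ ENNReal.ofReal (C * δ ^ (β : ℝ))) :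
    ∃ K : ℝ≥0, HolderOnWith K β u S := by
  refine ⟨C.toNNReal, fun x hx y hy => ?_⟩
  rw [edist_dist, edist_dist, Real.dist_eq, dist_eq_norm]
  refine (ofReal_abs_sub_le_modulusOfContinuity hx hy le_rfl).trans
    ((h _ (norm_nonneg _) (hR x hx y hy)).trans ?_)
  rw [ENNReal.ofReal_mul' (by positivity), ENNReal.ofReal_rpow_of_nonneg (norm_nonneg _) β.coe_nonneg]
  rfl

theorem mainTheorem1 (n : ℕ) (hn : 2 ≤ n) :
    ∃ C : ℝ, 0 < C ∧
      ∀ (Ω : Set (Rn n)) (L : Rn n ≃ᵃ[ℝ] Rn n) (Λ : ℝ) (f g u : Rn n → ℝ),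
        IsOpen Ω → Bornology.IsBounded Ω → Convex ℝ Ω →
        Set.MapsTo L Ω (Metric.ball 0 1) →
        IntegrableOn f Ω volume →
        (∀ᵐ x ∂(volume.restrict Ω), 0 ≤ f x ∧ f x ≤ Λ) →
        ConvexOn ℝ (closure Ω) g →
        IsAlexandrovSolution Ω f g u →
        (∀ δ : ℝ, 0 ≤ δ →
          modulusOfContinuity (closure Ω) u δ ≤
            modulusOfContinuity (closure Ω) g δ +
              ENNReal.ofReal (C * |affineDet L| ^ (-(2 / (n : ℝ))) * Λ ^ (1 / (n : ℝ)) *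
                growth n (affineNorm L * δ))) ∧
        (∀ α : ℝ≥0, 0 < α → α < 1 →
          (∃ K : ℝ≥0, HolderOnWith K α g (closure Ω)) →
          ∃ K : ℝ≥0, HolderOnWith K (min α (2 / (n : ℝ≥0))) u (closure Ω)) := by
  have hn0 : 0 < n := by omega
  refine ⟨40 * n, by positivity, fun Ω L Λ f g u hO hb hΩ hL _ hf hg hu => ?_⟩
  have hest : ∀ δ : ℝ, 0 ≤ δ → modulusOfContinuity (closure Ω) u δ ≤
      modulusOfContinuity (closure Ω) g δ +
        ENNReal.ofReal (40 * n * |affineDet L| ^ (-(2 / (n : ℝ))) * Λ ^ (1 / (n : ℝ)) *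
          growth n (affineNorm L * δ)) := by
    intro δ _
    refine iSup₂_le fun x hx => iSup₂_le fun y hy => iSup_le fun hxy => ?_
    have hΛ : 0 ≤ Λ := ae_bound_nonneg hO (closure_nonempty_iff.1 ⟨x, hx⟩) hf
    rcases le_total (u x) (u y) with h | h
    · rw [abs_sub_comm, abs_of_nonneg (sub_nonneg.2 h)]
      exact hu.ofReal_sub_le hn hO hb hΩ L hL hΛ hf hg hx hy hxy
    · rw [abs_of_nonneg (sub_nonneg.2 h)]
      exact hu.ofReal_sub_le hn hO hb hΩ L hL hΛ hf hg hy hx (by rwa [norm_sub_rev])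
  refine ⟨hest, ?_⟩
  rintro α hα hα1 ⟨K, hK⟩
  -- For empty `Ω` the almost-everywhere bound says nothing about the sign of `Λ`.
  rcases Ω.eq_empty_or_nonempty with rfl | hne
  · exact ⟨0, by simp [HolderOnWith]⟩
  have hΛ : 0 ≤ Λ := ae_bound_nonneg hO hne hf
  obtain ⟨R, hR⟩ := Metric.isBounded_iff.1 hb.closure
  set β : ℝ≥0 := min α (2 / (n : ℝ≥0)) with hβdef
  have hβ : (0 : ℝ) < β := by
    rw [NNReal.coe_pos, hβdef]
    exact lt_min hα (by positivity)
  have hβα : (β : ℝ) ≤ α := NNReal.coe_le_coe.2 (min_le_left _ _)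
  have hβn : (β : ℝ) ≤ 2 / (n : ℝ) := by
    have : β ≤ 2 / (n : ℝ≥0) := min_le_right _ _
    exact_mod_cast this
  have hβ1 : (β : ℝ) < 1 := hβα.trans_lt (by exact_mod_cast hα1)
  have hN : 0 ≤ affineNorm L := norm_nonneg _
  obtain ⟨C₁, hC₁, h₁⟩ := exists_rpow_le_mul_rpow hβ hβα R
  obtain ⟨C₂, hC₂, h₂⟩ := exists_growth_le_rpow hn hβ hβ1 hβn (affineNorm L * R)
  set Q := 40 * n * |affineDet L| ^ (-(2 / (n : ℝ))) * Λ ^ (1 / (n : ℝ)) with hQ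
  have hQ0 : 0 ≤ Q := by positivity
  refine exists_holderOnWith_of_modulusOfContinuity_le
    (C := K * C₁ + Q * (C₂ * affineNorm L ^ (β : ℝ))) (R := R)
    (fun x hx y hy => by rw [← dist_eq_norm]; exact hR hx hy) fun δ hδ hδR => ?_
  refine (hest δ hδ).trans ?_
  have hgr : growth n (affineNorm L * δ) ≤ C₂ * affineNorm L ^ (β : ℝ) * δ ^ (β : ℝ) := by
    refine (h₂ _ (by positivity) (by gcongr)).trans (le_of_eq ?_)
    rw [Real.mul_rpow hN hδ]
    ring
  calc _ ≤ ENNReal.ofReal (K * (C₁ * δ ^ (β : ℝ))) +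
        ENNReal.ofReal (Q * (C₂ * affineNorm L ^ (β : ℝ) * δ ^ (β : ℝ))) := by
        refine add_le_add ((modulusOfContinuity_le_of_holderOnWith hK δ).trans
          (ENNReal.ofReal_le_ofReal ?_)) (ENNReal.ofReal_le_ofReal ?_)
        · have := h₁ δ hδ hδR
          gcongr
        · gcongr
    _ = _ := by
        rw [← ENNReal.ofReal_add (by positivity) (by positivity)]
        congr 1
        ring
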